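/- Let $G=(P,E)$ be a finite simple undirected graph. An instance of a networked contest game with conflict graph $G$ consists of item values $v_{i,j}=v_{j,i}$ with $v_{i,j}>0$ if $(i,j)\in E$ and $v_{i,j}=0$ otherwise, and budgets $B_i>0$ for $i\in P$. Put $N_i=\{j : v_{i,j}>0\}$. Player $i$ chooses efforts $x_{i,j}\ge 0$, $j\in N_i$, with $\sum_{j\in N_i}x_{i,j}=B_i$ (if $N_i=\emptyset$, the player has only the empty allocation), and receives the payoff $U_i(x)=\sum_{j\in N_i}v_{i,j}\,\alpha(x_{i,j},x_{j,i})$, where $\alpha(s,t)=\frac{s}{s+t}$ for $(s,t)\neq(0,0)$ and $\alpha(0,0)=c$ with a fixed tie-breaking value $c\in(0,1)$. A Nash equilibrium is a (pure) profile of admissible allocations from which no player can strictly gain by a unilateral deviation. A transfer $\tau\in[0,B_a)$ from $a$ to $b$ replaces $B_a$ by $B_a-\tau$ and $B_b$ by $B_b+\tau$. It is mutually beneficial if the games before and after the transfer both have Nash equilibria, and $U_a(\tilde x)>U_a(x)$ and $U_b(\tilde x)>U_b(x)$ for every Nash equilibrium $x$ before and every Nash equilibrium $\tilde x$ after the transfer.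 Theorem. Let $G=(P,E)$ be any finite simple undirected graph, let $a\neq b$ be players in $P$, and suppose that $a$ and $b$ are joined by a path in the graph $(P,E\setminus\{(a,b)\})$. Then, for every tie-breaking value $c\in(0,1)$, there exists an instance $(v,B)$ of a networked contest game with conflict graph $G$ for which some transfer $\tau>0$ from $a$ to $b$ is mutually beneficial. -/

import Mathlib

open scoped Classical in
/-- The Tullock lottery contest success function: the probability `s / (s + t)` of winning an item
with effort `s` against effort `t`, with the tie-breaking value `c` when both efforts are zero. -/
noncomputable def tullock (c s t : ℝ) : ℝ :=
  if s = 0 ∧ t = 0 then c else s / (s + t)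

/-- `v` and `B` are item values and budgets of a networked contest game whose conflict graph is `G`:
the values are symmetric, positive on the edges of `G` and zero elsewhere, and all budgets are
positive. -/
structure IsContestInstance {P : Type*} (G : SimpleGraph P) (v : P → P → ℝ) (B : P → ℝ) :
    Prop where
  symm : ∀ i j, v i j = v j i
  pos_of_adj : ∀ i j, G.Adj i j → 0 < v i j
  zero_of_not_adj : ∀ i j, ¬ G.Adj i j → v i j = 0
  budget_pos : ∀ i, 0 < B i

open scoped Classical in
/-- The rivals of player `i`: the players with whom `i` contests an item of positive value. -/
noncomputable def rivals {P : Type*} [Fintype P] (v : P → P → ℝ) (i : P) : Finset P :=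
  Finset.univ.filter (fun j => 0 < v i j)

/-- `y` is an admissible allocation of player `i`: nonnegative efforts on the items that `i`
contests (and no effort elsewhere) that add up to the budget of `i`. A player who contests no item
has the zero allocation as the only action. -/
structure IsAction {P : Type*} [Fintype P] (v : P → P → ℝ) (B : P → ℝ) (i : P) (y : P → ℝ) :
    Prop where
  nonneg : ∀ j, 0 ≤ y j
  eq_zero : ∀ j, j ∉ rivals v i → y j = 0
  sum_eq : (rivals v i).Nonempty → ∑ j ∈ rivals v i, y j = B i

/-- The payoff of player `i` at the profile `x`, where `x i j` is the effort of `i` against `j`. -/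
noncomputable def payoff {P : Type*} [Fintype P] (c : ℝ) (v : P → P → ℝ) (i : P)
    (x : P → P → ℝ) : ℝ :=
  ∑ j ∈ rivals v i, v i j * tullock c (x i j) (x j i)

open scoped Classical in
/-- `x` is a (pure) Nash equilibrium of the game with values `v` and budgets `B`. -/
structure IsNashEquilibrium {P : Type*} [Fintype P] (c : ℝ) (v : P → P → ℝ) (B : P → ℝ)
    (x : P → P → ℝ) : Prop where
  isAction : ∀ i, IsAction v B i (x i)
  no_deviation : ∀ i (y : P → ℝ), IsAction v B i y →
    payoff c v i (Function.update x i y) ≤ payoff c v i x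

open scoped Classical in
/-- The budgets after player `a` has transferred the amount `τ` to player `b`. -/
noncomputable def transferBudget {P : Type*} (B : P → ℝ) (a b : P) (τ : ℝ) : P → ℝ :=
  B + τ • (Pi.single b 1 - Pi.single a 1)

/-- The transfer of `τ ∈ [0, B a)` from `a` to `b` is mutually beneficial: the games before and
after the transfer have Nash equilibria, and the equilibrium payoffs of both `a` and `b` are
strictly larger after the transfer, whichever equilibria are compared. -/
structure IsMutuallyBeneficial {P : Type*} [Fintype P] (c : ℝ) (v : P → P → ℝ) (B : P → ℝ)
    (a b : P) (τ : ℝ) : Prop where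
  nonneg : 0 ≤ τ
  lt_budget : τ < B a
  exists_before : ∃ x, IsNashEquilibrium c v B x
  exists_after : ∃ x', IsNashEquilibrium c v (transferBudget B a b τ) x'
  improves : ∀ x x', IsNashEquilibrium c v B x →
    IsNashEquilibrium c v (transferBudget B a b τ) x' →
      payoff c v a x < payoff c v a x' ∧ payoff c v b x < payoff c v b x'

/-! Prescribe the Lagrange multipliers `l i > 0` of the budget constraints instead of the budgets.
The first-order conditions on an item give efforts `v i j * l j / (l i + l j) ^ 2` and winning
probability `l j / (l i + l j)`, so budgets and payoffs are explicit functions of `l`. Concavity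
makes this profile an equilibrium. It is the only one, since every item is constant-sum and
deviations from it lose an explicit square (`eq_effort`).

The derivative of spending in `l` is negative definite on non-isolated players, because the cross
terms of its quadratic form cancel. The inverse function theorem therefore turns a direction `d`
that shifts budget from `a` to `b` and raises both payoffs to first order into a finite transfer
(`exists_isMutuallyBeneficial`).

Such a direction is built on a path of length at least two from `a` to `b`
(`exists_beneficial_chain`). The neighbour of `a` withdraws more effort from `a` than `a` gives up.
The disturbance is passed along so that intermediate budgets stay fixed and `b` absorbs exactly what
`a` lost. All other edges of the graph, possibly including the edge between `a` and `b`, then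
receive a small value `ε`, which preserves the strict inequalities
(`exists_isContestInstance_of_subgraph`). -/

/-! ### The lottery success function. -/

theorem tullock_of_pos_right {c s t : ℝ} (ht : 0 < t) : tullock c s t = s / (s + t) := by
  rw [tullock, if_neg (fun h => ht.ne' h.2)]

theorem tullock_of_pos_left {c s t : ℝ} (hs : 0 < s) : tullock c s t = s / (s + t) := by
  rw [tullock, if_neg (fun h => hs.ne' h.1)]

theorem tullock_zero_zero (c : ℝ) : tullock c 0 0 = c := by
  rw [tullock, if_pos ⟨rfl, rfl⟩]

theorem tullock_add_tullock {c s t : ℝ} (hs : 0 ≤ s) (ht : 0 ≤ t) (h : ¬ (s = 0 ∧ t = 0)) :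
    tullock c s t + tullock c t s = 1 := by
  have h' : ¬ (t = 0 ∧ s = 0) := fun h' => h h'.symm
  have hst : s + t ≠ 0 := fun h0 => h ⟨by linarith, by linarith⟩
  rw [tullock, tullock, if_neg h, if_neg h', add_comm t s, ← add_div, div_self hst]

/-- The success function minus its tangent line at `x` is an explicit nonpositive quantity. -/
theorem tullock_eq_tangent_sub {c s x t : ℝ} (hs : 0 ≤ s) (hx : 0 ≤ x) (ht : 0 < t) :
    tullock c s t = tullock c x t + t / (x + t) ^ 2 * (s - x)
      - t * (s - x) ^ 2 / ((s + t) * (x + t) ^ 2) := by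
  rw [tullock_of_pos_right ht, tullock_of_pos_right ht]
  have h1 : s + t ≠ 0 := by positivity
  have h2 : x + t ≠ 0 := by positivity
  field_simp
  ring

/-- Moving a fraction `r` of the way to a positive effort costs at most the fraction `r`. -/
theorem mul_tullock_le_tullock {c r s x t : ℝ} (hr : 0 < r) (hr1 : r < 1)
    (hs : 0 ≤ s) (hx : 0 < x) (ht : 0 ≤ t) (hst : ¬ (s = 0 ∧ t = 0)) :
    (1 - r) * tullock c s t ≤ tullock c ((1 - r) * s + r * x) t := by
  have hz : 0 < (1 - r) * s + r * x := by
    have := mul_nonneg (sub_nonneg.2 hr1.le) hs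
    have := mul_pos hr hx
    linarith
  have hst' : 0 < s + t := by
    rcases hs.lt_or_eq with h | h
    · linarith
    · rcases ht.lt_or_eq with h' | h'
      · linarith
      · exact absurd ⟨h.symm, h'.symm⟩ hst
  rw [tullock_of_pos_left hz, tullock, if_neg hst, ← mul_div_assoc,
    div_le_div_iff₀ hst' (by linarith)]
  have h1 : 0 ≤ (1 - r) * s := mul_nonneg (sub_nonneg.2 hr1.le) hs
  have h2 : 0 ≤ r * x := by positivity
  have h3 : 0 ≤ r * s := mul_nonneg hr.le hs
  linarith [mul_nonneg h1 h3, mul_nonneg h2 h3, mul_nonneg h2 ht]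

/-- A double sum depends only on the symmetrization of its summand. This serves both the
constant-sum argument and the cancellation of cross terms in the quadratic form. -/
theorem sum_sum_eq_of_symm {P : Type*} [Fintype P] {f g : P → P → ℝ}
    (h : ∀ i j, f i j + f j i = g i j + g j i) : ∑ i, ∑ j, f i j = ∑ i, ∑ j, g i j := by
  have hf : ∑ i, ∑ j, f i j = ∑ i, ∑ j, f j i := Finset.sum_comm
  have hg : ∑ i, ∑ j, g i j = ∑ i, ∑ j, g j i := Finset.sum_comm
  have : ∑ i, ∑ j, (f i j + f j i) = ∑ i, ∑ j, (g i j + g j i) :=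
    Finset.sum_congr rfl fun i _ => Finset.sum_congr rfl fun j _ => h i j
  simp only [Finset.sum_add_distrib] at this
  linarith

/-! ### Equilibria parametrized by multipliers. -/

/-- The profile of efforts in which every player `i` has the marginal payoff `l i` on each of the
contested items. -/
noncomputable def effort {P : Type*} (v : P → P → ℝ) (l : P → ℝ) (i j : P) : ℝ :=
  v i j * (l j / (l i + l j) ^ 2)

/-- The total effort of player `i` in the profile `effort v l`. -/
noncomputable def spending {P : Type*} [Fintype P] (v : P → P → ℝ) (l : P → ℝ) (i : P) : ℝ :=
  ∑ j, v i j * (l j / (l i + l j) ^ 2)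

/-- The payoff of player `i` in the profile `effort v l`. -/
noncomputable def gain {P : Type*} [Fintype P] (v : P → P → ℝ) (l : P → ℝ) (i : P) : ℝ :=
  ∑ j, v i j * (l j / (l i + l j))

section Equilibrium

variable {P : Type*} [Fintype P] {G : SimpleGraph P} {v : P → P → ℝ} {B l : P → ℝ} {c : ℝ}

theorem IsContestInstance.mem_rivals (hv : IsContestInstance G v B) {i j : P} :
    j ∈ rivals v i ↔ G.Adj i j := by
  simp only [rivals, Finset.mem_filter, Finset.mem_univ, true_and]
  refine ⟨fun h => ?_, hv.pos_of_adj i j⟩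
  by_contra hij
  exact h.ne' (hv.zero_of_not_adj i j hij)

theorem IsContestInstance.sum_rivals (hv : IsContestInstance G v B) (i : P) (g : P → ℝ) :
    ∑ j ∈ rivals v i, v i j * g j = ∑ j, v i j * g j := by
  refine Finset.sum_subset (Finset.subset_univ _) fun j _ hj => ?_
  rw [hv.zero_of_not_adj i j (fun h => hj (hv.mem_rivals.2 h)), zero_mul]

open scoped Classical in
theorem IsContestInstance.payoff_update (hv : IsContestInstance G v B) (x : P → P → ℝ) (i : P)
    (y : P → ℝ) :
    payoff c v i (Function.update x i y) = ∑ j, v i j * tullock c (y j) (x j i) := by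
  rw [payoff, hv.sum_rivals]
  refine Finset.sum_congr rfl fun j _ => ?_
  by_cases hij : G.Adj i j
  · rw [Function.update_self, Function.update_of_ne hij.ne']
  · rw [hv.zero_of_not_adj i j hij, zero_mul, zero_mul]

theorem IsContestInstance.payoff_eq (hv : IsContestInstance G v B) (x : P → P → ℝ) (i : P) :
    payoff c v i x = ∑ j, v i j * tullock c (x i j) (x j i) := hv.sum_rivals _ _

theorem IsContestInstance.effort_pos (hv : IsContestInstance G v B) (hl : ∀ i, 0 < l i) {i j : P}
    (hij : G.Adj i j) : 0 < effort v l i j := by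
  have := hv.pos_of_adj i j hij
  have := hl i
  have := hl j
  unfold effort
  positivity

theorem IsContestInstance.payoff_effort (hv : IsContestInstance G v B) (hl : ∀ i, 0 < l i)
    (i : P) : payoff c v i (effort v l) = gain v l i := by
  rw [hv.payoff_eq, gain]
  refine Finset.sum_congr rfl fun j _ => ?_
  by_cases hij : G.Adj i j
  · rw [tullock_of_pos_left (hv.effort_pos hl hij), effort, effort, hv.symm j i]
    have := hv.pos_of_adj i j hij
    have := hl i
    have := hl j
    congr 1
    rw [add_comm (l j) (l i)]
    field_simp
    ring
  · rw [hv.zero_of_not_adj i j hij, zero_mul, zero_mul]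

theorem IsContestInstance.isAction_effort (hv : IsContestInstance G v B) (hl : ∀ i, 0 < l i)
    (hB : ∀ i j, G.Adj i j → B i = spending v l i) (i : P) : IsAction v B i (effort v l i) where
  nonneg j := by
    by_cases hij : G.Adj i j
    · exact (hv.effort_pos hl hij).le
    · rw [effort, hv.zero_of_not_adj i j hij, zero_mul]
  eq_zero j hj := by
    rw [effort, hv.zero_of_not_adj i j (fun h => hj (hv.mem_rivals.2 h)), zero_mul]
  sum_eq := by
    rintro ⟨j, hj⟩
    rw [hB i j (hv.mem_rivals.1 hj)]
    exact hv.sum_rivals i _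

/-- Every action of `i` loses an explicit amount against the profile `effort v l`. -/
theorem IsContestInstance.payoff_update_effort (hv : IsContestInstance G v B)
    (hl : ∀ i, 0 < l i) (hB : ∀ i j, G.Adj i j → B i = spending v l i) {i : P} {y : P → ℝ}
    (hy : IsAction v B i y) :
    ∑ j, v i j * tullock c (y j) (effort v l j i) = payoff c v i (effort v l) -
      ∑ j, v i j * (effort v l j i * (y j - effort v l i j) ^ 2 /
        ((y j + effort v l j i) * (effort v l i j + effort v l j i) ^ 2)) := by
  have hx := hv.isAction_effort hl hB i
  -- The tangent slope equals `l i` on every item, and all actions have the same total effort, so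
  -- the first-order terms cancel and only the quadratic loss remains.
  have hsum : ∑ j ∈ rivals v i, l i * (y j - effort v l i j) = 0 := by
    rw [← Finset.mul_sum, Finset.sum_sub_distrib]
    rcases (rivals v i).eq_empty_or_nonempty with h | h
    · simp [h]
    · rw [hy.sum_eq h, hx.sum_eq h, sub_self, mul_zero]
  rw [← hv.sum_rivals, ← hv.sum_rivals, payoff, ← Finset.sum_sub_distrib,
    ← add_zero (∑ j ∈ rivals v i, (_ - _)), ← hsum, ← Finset.sum_add_distrib]
  refine Finset.sum_congr rfl fun j hj => ?_
  have hij := hv.mem_rivals.1 hj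
  have hvp := hv.pos_of_adj i j hij
  have hmarg : v i j * (effort v l j i / (effort v l i j + effort v l j i) ^ 2) = l i := by
    have := hl i
    have := hl j
    rw [effort, effort, hv.symm j i, add_comm (l j) (l i)]
    field_simp
    ring
  rw [tullock_eq_tangent_sub (hy.nonneg j) (hv.effort_pos hl hij).le (hv.effort_pos hl hij.symm),
    ← hmarg]
  ring

theorem IsContestInstance.isNashEquilibrium_effort (hv : IsContestInstance G v B)
    (hl : ∀ i, 0 < l i) (hB : ∀ i j, G.Adj i j → B i = spending v l i) :
    IsNashEquilibrium c v B (effort v l) where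
  isAction := hv.isAction_effort hl hB
  no_deviation i y hy := by
    rw [hv.payoff_update, hv.payoff_update_effort hl hB hy, sub_le_self_iff]
    refine Finset.sum_nonneg fun j _ => ?_
    by_cases hij : G.Adj i j
    · have := hv.pos_of_adj i j hij
      have := hv.effort_pos hl hij
      have := hv.effort_pos hl hij.symm
      have := hy.nonneg j
      positivity
    · rw [hv.zero_of_not_adj i j hij, zero_mul]

/-- If some admissible profile puts positive effort on every contested item, then an equilibrium
leaves no contested item without effort. -/
theorem IsContestInstance.not_tie (hv : IsContestInstance G v B) (hc : c ∈ Set.Ioo (0 : ℝ) 1)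
    {x y : P → P → ℝ} (hx : ∀ i, IsAction v B i (x i)) (hxpos : ∀ i j, G.Adj i j → 0 < x i j)
    (hy : IsNashEquilibrium c v B y) {i j : P} (hij : G.Adj i j) :
    ¬ (y i j = 0 ∧ y j i = 0) := by
  intro htie
  have hvij := hv.pos_of_adj i j hij
  -- Moving a fraction `r` towards `x` wins the tied item outright, a gain of at least `v i j * (1 -
  -- c)`, while at most the fraction `r` of the payoff is lost.
  have key : ∀ r : ℝ, 0 < r → r < 1 →
      (1 - r) * payoff c v i y + v i j * (1 - c) ≤ payoff c v i y := by
    intro r hr hr1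
    have hz : IsAction v B i (fun k => (1 - r) * y i k + r * x i k) :=
      { nonneg := fun k => add_nonneg (mul_nonneg (by linarith) ((hy.isAction i).nonneg k))
          (mul_nonneg hr.le ((hx i).nonneg k))
        eq_zero := fun k hk => by
          rw [(hy.isAction i).eq_zero k hk, (hx i).eq_zero k hk]; ring
        sum_eq := fun h => by
          rw [Finset.sum_add_distrib, ← Finset.mul_sum, ← Finset.mul_sum, (hx i).sum_eq h,
            (hy.isAction i).sum_eq h]; ring }
    refine le_trans ?_ (hy.no_deviation i _ hz)
    classical
    rw [hv.payoff_update, hv.payoff_eq, Finset.mul_sum,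
      ← Finset.add_sum_erase _ _ (Finset.mem_univ j),
      ← Finset.add_sum_erase _ _ (Finset.mem_univ j)]
    have tie_term : ∀ k, G.Adj i k → y i k = 0 → y k i = 0 →
        (1 - r) * (v i k * tullock c (y i k) (y k i)) + v i k * (1 - c) ≤
          v i k * tullock c ((1 - r) * y i k + r * x i k) (y k i) := by
      intro k hk h1 h2
      have hxk := hxpos i k hk
      have hvk := hv.pos_of_adj i k hk
      rw [h1, h2, tullock_zero_zero, mul_zero, zero_add, tullock_of_pos_left (by positivity),
        add_zero, div_self (by positivity)]
      nlinarith [mul_pos (mul_pos hvk hr) hc.1]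
    have h1 := tie_term j hij htie.1 htie.2
    have h2 : ∑ k ∈ Finset.univ.erase j, (1 - r) * (v i k * tullock c (y i k) (y k i)) ≤
        ∑ k ∈ Finset.univ.erase j, v i k * tullock c ((1 - r) * y i k + r * x i k) (y k i) := by
      refine Finset.sum_le_sum fun k _ => ?_
      by_cases hk : G.Adj i k
      · have hvk := hv.pos_of_adj i k hk
        by_cases ht : y i k = 0 ∧ y k i = 0
        · have := tie_term k hk ht.1 ht.2
          have := mul_pos hvk (sub_pos.2 hc.2)
          linarith
        · have := mul_le_mul_of_nonneg_left (mul_tullock_le_tullock (c := c) hr hr1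
            ((hy.isAction i).nonneg k) (hxpos i k hk) ((hy.isAction k).nonneg i) ht) hvk.le
          linarith
      · simp [hv.zero_of_not_adj i k hk]
    linarith
  have hd : 0 < v i j * (1 - c) := mul_pos hvij (sub_pos.2 hc.2)
  have h2 := key (1 / 2) (by norm_num) (by norm_num)
  have hU : 0 < payoff c v i y := by linarith
  set U := payoff c v i y
  set d := v i j * (1 - c)
  -- This `r` is small enough that the loss `r * U` is less than `d`.
  have h3 := key (d / (2 * (U + d))) (by positivity) (by rw [div_lt_one (by positivity)]; linarith)
  have h4 : d / (2 * (U + d)) * U < d := by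
    rw [div_mul_eq_mul_div, div_lt_iff₀ (by positivity)]
    nlinarith [mul_pos hd hU, mul_pos hd hd]
  linarith

/-- Equilibria of constant-sum interactions are interchangeable: `y i` is also a best response to
`x`, and the explicit quadratic loss then forces `y i = x i`. -/
theorem IsContestInstance.eq_effort (hv : IsContestInstance G v B) (hc : c ∈ Set.Ioo (0 : ℝ) 1)
    (hl : ∀ i, 0 < l i) (hB : ∀ i j, G.Adj i j → B i = spending v l i)
    {y : P → P → ℝ} (hy : IsNashEquilibrium c v B y) : y = effort v l := by
  classical
  set x := effort v l with hxdef
  have hxN : IsNashEquilibrium c v B x := hv.isNashEquilibrium_effort hl hB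
  have hxpos : ∀ i j, G.Adj i j → 0 < x i j := fun i j h => hv.effort_pos hl h
  have h1 : ∀ i, 0 ≤ payoff c v i x - ∑ j, v i j * tullock c (y i j) (x j i) := fun i => by
    have := hxN.no_deviation i _ (hy.isAction i)
    rw [hv.payoff_update] at this
    linarith
  have h2 : ∀ i, 0 ≤ payoff c v i y - ∑ j, v i j * tullock c (x i j) (y j i) := fun i => by
    have := hy.no_deviation i _ (hxN.isAction i)
    rw [hv.payoff_update] at this
    linarith
  -- Without ties, the two shares of each item add up to one in `x`, in `y` and in both mixed
  -- profiles, so the nonnegative regrets sum to zero.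
  have hsum : ∑ i, ((payoff c v i x - ∑ j, v i j * tullock c (y i j) (x j i)) +
      (payoff c v i y - ∑ j, v i j * tullock c (x i j) (y j i))) = 0 := by
    have : ∑ i, ∑ j, v i j * (tullock c (x i j) (x j i) + tullock c (y i j) (y j i)) =
        ∑ i, ∑ j, v i j * (tullock c (y i j) (x j i) + tullock c (x i j) (y j i)) := by
      refine sum_sum_eq_of_symm fun i j => ?_
      by_cases hij : G.Adj i j
      · have nx := fun i j => (hxN.isAction i).nonneg j
        have ny := fun i j => (hy.isAction i).nonneg j
        have e1 := tullock_add_tullock (c := c) (nx i j) (nx j i)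
          (fun h => (hxpos i j hij).ne' h.1)
        have e2 := tullock_add_tullock (c := c) (ny i j) (ny j i)
          (hv.not_tie hc hxN.isAction hxpos hy hij)
        have e3 := tullock_add_tullock (c := c) (nx i j) (ny j i)
          (fun h => (hxpos i j hij).ne' h.1)
        have e4 := tullock_add_tullock (c := c) (nx j i) (ny i j)
          (fun h => (hxpos j i hij.symm).ne' h.1)
        rw [hv.symm j i]
        linear_combination v i j * (e1 + e2 - e3 - e4)
      · rw [hv.symm j i, hv.zero_of_not_adj i j hij]; simp
    simp only [hv.payoff_eq, ← Finset.sum_sub_distrib, ← Finset.sum_add_distrib]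
    simp only [mul_add] at this
    rw [← sub_eq_zero, ← Finset.sum_sub_distrib] at this
    rw [← this]
    refine Finset.sum_congr rfl fun i _ => ?_
    rw [← Finset.sum_sub_distrib]
    exact Finset.sum_congr rfl fun j _ => by ring
  rw [Finset.sum_eq_zero_iff_of_nonneg fun i _ => add_nonneg (h1 i) (h2 i)] at hsum
  funext i j
  have hi : payoff c v i x - ∑ j, v i j * tullock c (y i j) (x j i) = 0 := by
    have := hsum i (Finset.mem_univ i)
    linarith [h1 i, h2 i]
  rw [hv.payoff_update_effort hl hB (hy.isAction i), sub_sub_cancel,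
    Finset.sum_eq_zero_iff_of_nonneg] at hi
  · by_cases hij : G.Adj i j
    · have := hi j (Finset.mem_univ j)
      have hvp := hv.pos_of_adj i j hij
      have p1 := hxpos i j hij
      have p2 := hxpos j i hij.symm
      have p3 := (hy.isAction i).nonneg j
      rw [← hxdef] at this
      have p4 : (y i j + x j i) * (x i j + x j i) ^ 2 ≠ 0 := by positivity
      simp only [mul_eq_zero, hvp.ne', div_eq_zero_iff, p2.ne', p4, false_or, or_false] at this
      exact sub_eq_zero.1 (pow_eq_zero_iff (two_ne_zero)|>.1 this)
    · have hj : j ∉ rivals v i := fun h => hij (hv.mem_rivals.1 h)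
      rw [(hy.isAction i).eq_zero j hj, (hxN.isAction i).eq_zero j hj]
  · intro k _
    by_cases hik : G.Adj i k
    · have := hv.pos_of_adj i k hik
      have p1 := hxpos i k hik
      have p2 := hxpos k i hik.symm
      have p3 := (hy.isAction i).nonneg k
      rw [← hxdef]
      positivity
    · rw [hv.zero_of_not_adj i k hik, zero_mul]

end Equilibrium

/-! ### From first-order directions to transfers. -/

open Filter Topology in
theorem HasDerivAt.eventually_lt_of_pos {f : ℝ → ℝ} {f' x : ℝ} (hf : HasDerivAt f f' x)
    (hpos : 0 < f') : ∀ᶠ y in 𝓝[>] x, f x < f y := by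
  have h := (hasDerivAt_iff_tendsto_slope.1 hf).eventually_const_lt hpos
  have h' := h.filter_mono (nhdsWithin_mono x fun y (hy : x < y) => hy.ne')
  filter_upwards [h', self_mem_nhdsWithin] with y hy hxy
  exact (slope_pos_iff_of_le (le_of_lt hxy)).1 hy

/-- The derivative, in the direction `d`, of the effort that `i` spends on a unit item contested
with `j`. -/
noncomputable def effortDeriv {P : Type*} (l d : P → ℝ) (i j : P) : ℝ :=
  ((l i - l j) * d j - 2 * l j * d i) / (l i + l j) ^ 3

/-- The derivative of `spending v` at `l` in the direction `d`. -/
noncomputable def spendingDeriv {P : Type*} [Fintype P] (v : P → P → ℝ) (l d : P → ℝ) (i : P) :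
    ℝ :=
  ∑ j, v i j * effortDeriv l d i j

/-- The derivative of `gain v` at `l` in the direction `d`. -/
noncomputable def gainDeriv {P : Type*} [Fintype P] (v : P → P → ℝ) (l d : P → ℝ) (i : P) : ℝ :=
  ∑ j, v i j * ((l i * d j - l j * d i) / (l i + l j) ^ 2)

open scoped Classical in
/-- The indicator function of the isolated vertices. -/
noncomputable def isolated {P : Type*} (G : SimpleGraph P) (i : P) : ℝ :=
  if ∃ j, G.Adj i j then 0 else 1

theorem isolated_of_adj {P : Type*} {G : SimpleGraph P} {i j : P} (h : G.Adj i j) :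
    isolated G i = 0 := if_pos ⟨j, h⟩

theorem isolated_of_forall {P : Type*} {G : SimpleGraph P} {i : P} (h : ∀ j, ¬ G.Adj i j) :
    isolated G i = 1 := if_neg (not_exists.2 h)

theorem effortDeriv_add {P : Type*} (l d e : P → ℝ) (i j : P) :
    effortDeriv l (d + e) i j = effortDeriv l d i j + effortDeriv l e i j := by
  simp only [effortDeriv, Pi.add_apply]; ring

theorem effortDeriv_smul {P : Type*} (l d : P → ℝ) (t : ℝ) (i j : P) :
    effortDeriv l (t • d) i j = t * effortDeriv l d i j := by
  simp only [effortDeriv, Pi.smul_apply, smul_eq_mul]; ring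

section Derivatives

variable {P : Type*} [Fintype P] {G : SimpleGraph P} {v : P → P → ℝ} {B l d : P → ℝ} {c : ℝ}

theorem spendingDeriv_add (v : P → P → ℝ) (l d e : P → ℝ) (i : P) :
    spendingDeriv v l (d + e) i = spendingDeriv v l d i + spendingDeriv v l e i := by
  simp only [spendingDeriv, effortDeriv_add, mul_add, Finset.sum_add_distrib]

theorem spendingDeriv_smul (v : P → P → ℝ) (l d : P → ℝ) (t : ℝ) (i : P) :
    spendingDeriv v l (t • d) i = t * spendingDeriv v l d i := by
  simp only [spendingDeriv, effortDeriv_smul, Finset.mul_sum, mul_left_comm]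

theorem spendingDeriv_add_smul (v g : P → P → ℝ) (l d : P → ℝ) (t : ℝ) (i : P) :
    spendingDeriv (v + t • g) l d i = spendingDeriv v l d i + t * spendingDeriv g l d i := by
  simp only [spendingDeriv, Finset.mul_sum, ← Finset.sum_add_distrib, Pi.add_apply,
    Pi.smul_apply, smul_eq_mul, add_mul, mul_assoc]

/-- The derivative of the spending is negative definite on the players with an item. -/
theorem eq_zero_of_mul_spendingDeriv_eq_zero (hsymm : ∀ i j, v i j = v j i)
    (hnn : ∀ i j, 0 ≤ v i j) (hl : ∀ i, 0 < l i) (h : ∀ i, d i * spendingDeriv v l d i = 0)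
    {i j : P} (hij : v i j ≠ 0) : d i = 0 := by
  -- In the quadratic form, the terms in `d i * d j` from the two orders of a pair have opposite
  -- coefficients `l i - l j` and `l j - l i`.
  have h0 : ∑ i, ∑ j, v i j * (2 * l j * d i ^ 2 / (l i + l j) ^ 3) = 0 := by
    have e : ∑ i, ∑ j, d i * (v i j * effortDeriv l d i j) =
        ∑ i, ∑ j, -(v i j * (2 * l j * d i ^ 2 / (l i + l j) ^ 3)) := by
      refine sum_sum_eq_of_symm fun i j => ?_
      rw [hsymm j i, effortDeriv, effortDeriv, add_comm (l j) (l i)]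
      ring
    simp only [Finset.sum_neg_distrib, ← Finset.mul_sum] at e
    rw [← neg_eq_zero, ← e]
    exact Finset.sum_eq_zero fun i _ => h i
  have hterm : ∀ i j, 0 ≤ v i j * (2 * l j * d i ^ 2 / (l i + l j) ^ 3) := fun i j => by
    have := hnn i j
    have := hl i
    have := hl j
    positivity
  rw [Finset.sum_eq_zero_iff_of_nonneg fun i _ => Finset.sum_nonneg fun j _ => hterm i j] at h0
  have h1 := h0 i (Finset.mem_univ i)
  rw [Finset.sum_eq_zero_iff_of_nonneg fun j _ => hterm i j] at h1
  have h2 := h1 j (Finset.mem_univ j)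
  have h3 := hl i
  have h4 := hl j
  have h5 : (l i + l j) ^ 3 ≠ 0 := by positivity
  simpa [hij, h4.ne', h5] using h2

/-- `spendingDeriv` as a linear map, with the isolated vertices regularized. -/
noncomputable def spendingDerivCLM (G : SimpleGraph P) (v : P → P → ℝ) (l : P → ℝ) :
    (P → ℝ) →L[ℝ] (P → ℝ) :=
  LinearMap.toContinuousLinearMap
    { toFun := fun d i => spendingDeriv v l d i + isolated G i * d i
      map_add' := fun d e => by
        funext i
        simp only [spendingDeriv_add, Pi.add_apply]
        ring
      map_smul' := fun t d => by
        funext i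
        simp only [spendingDeriv_smul, Pi.smul_apply, smul_eq_mul, RingHom.id_apply]
        ring }

theorem spendingDerivCLM_apply (G : SimpleGraph P) (v : P → P → ℝ) (l d : P → ℝ) (i : P) :
    spendingDerivCLM G v l d i = spendingDeriv v l d i + isolated G i * d i := rfl

theorem hasStrictFDerivAt_spending (G : SimpleGraph P) (v : P → P → ℝ) (hl : ∀ i, 0 < l i) :
    HasStrictFDerivAt (fun (m : P → ℝ) i => spending v m i + isolated G i * m i)
      (spendingDerivCLM G v l) l := by
  refine hasStrictFDerivAt_pi'' fun i => ?_
  have hp : ∀ j, HasStrictFDerivAt (fun m : P → ℝ => m j)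
      (ContinuousLinearMap.proj (R := ℝ) (φ := fun _ : P => ℝ) j) l :=
    fun j => hasStrictFDerivAt_apply j l
  have hterm : ∀ j, HasStrictFDerivAt (fun m : P → ℝ => v i j * (m j / (m i + m j) ^ 2)) _ l :=
    fun j => (((hp j).fun_mul ((hasStrictDerivAt_inv (by
      have := hl i; have := hl j; positivity : (l i + l j) ^ 2 ≠ 0)).comp_hasStrictFDerivAt l
        (((hp i).add (hp j)).pow 2))).const_mul (v i j))
  have hsum := (HasStrictFDerivAt.fun_sum (u := Finset.univ) fun j _ => hterm j).add
    ((hp i).const_mul (isolated G i))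
  refine hsum.congr_fderiv ?_
  ext d
  simp only [add_apply, ContinuousLinearMap.coe_comp, Function.comp_apply,
    ContinuousLinearMap.proj_apply, spendingDerivCLM_apply, spendingDeriv,
    sum_apply, smul_apply, smul_eq_mul]
  congr 1
  refine Finset.sum_congr rfl fun j _ => ?_
  have := hl i
  have := hl j
  rw [effortDeriv]
  congr 1
  simp
  field_simp
  ring

theorem hasDerivAt_gain (v : P → P → ℝ) {γ : ℝ → P → ℝ} (hl : ∀ i, 0 < γ 0 i)
    (hγ : HasDerivAt γ d 0) (i : P) :
    HasDerivAt (fun τ => gain v (γ τ) i) (gainDeriv v (γ 0) d i) 0 := by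
  have hp : ∀ j, HasDerivAt (fun τ => γ τ j) (d j) 0 := hasDerivAt_pi.1 hγ
  refine HasDerivAt.fun_sum fun j _ => ?_
  have h := (hp j).div ((hp i).add (hp j)) (add_pos (hl i) (hl j)).ne'
  refine (h.const_mul (v i j)).congr_deriv ?_
  simp only [Pi.add_apply]
  ring

theorem IsContestInstance.spending_add_isolated_pos (hv : IsContestInstance G v B)
    (hl : ∀ i, 0 < l i) (i : P) : 0 < spending v l i + isolated G i * l i := by
  by_cases h : ∃ j, G.Adj i j
  · obtain ⟨j, hj⟩ := h
    rw [isolated_of_adj hj, zero_mul, add_zero]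
    refine Finset.sum_pos' (fun k _ => ?_) ⟨j, Finset.mem_univ j, hv.effort_pos hl hj⟩
    by_cases hk : G.Adj i k
    · exact (hv.effort_pos hl hk).le
    · rw [hv.zero_of_not_adj i k hk, zero_mul]
  · rw [isolated_of_forall (not_exists.1 h), one_mul, spending, Finset.sum_eq_zero, zero_add]
    · exact hl i
    · intro k _
      rw [hv.zero_of_not_adj i k (not_exists.1 h k), zero_mul]

theorem IsContestInstance.injective_spendingDerivCLM (hv : IsContestInstance G v B)
    (hl : ∀ i, 0 < l i) : Function.Injective (spendingDerivCLM G v l) := by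
  rw [injective_iff_map_eq_zero]
  intro d hd
  have hnn : ∀ i j, 0 ≤ v i j := fun i j => by
    by_cases h : G.Adj i j
    · exact (hv.pos_of_adj i j h).le
    · exact (hv.zero_of_not_adj i j h).ge
  have hd' : ∀ i, spendingDeriv v l d i + isolated G i * d i = 0 := fun i => congrFun hd i
  funext i
  by_cases h : ∃ j, G.Adj i j
  · obtain ⟨j, hj⟩ := h
    refine eq_zero_of_mul_spendingDeriv_eq_zero hv.symm hnn hl (fun k => ?_)
      (hv.pos_of_adj i j hj).ne'
    have hk := hd' k
    by_cases h : ∃ j, G.Adj k j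
    · obtain ⟨j, hj⟩ := h
      rw [isolated_of_adj hj, zero_mul, add_zero] at hk
      rw [hk, mul_zero]
    · rw [spendingDeriv, Finset.sum_eq_zero, mul_zero]
      intro j _
      rw [hv.zero_of_not_adj k j (not_exists.1 h j), zero_mul]
  · have := hd' i
    rw [isolated_of_forall (not_exists.1 h), spendingDeriv, Finset.sum_eq_zero] at this
    · simpa using this
    · intro j _
      rw [hv.zero_of_not_adj i j (not_exists.1 h j), zero_mul]

open scoped Classical in
open Filter Topology in
/-- A direction of multipliers that shifts budget from `a` to `b` and increases the equilibrium
payoffs of both to first order yields a mutually beneficial transfer. -/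
theorem IsContestInstance.exists_isMutuallyBeneficial (hv : IsContestInstance G v B)
    (hc : c ∈ Set.Ioo (0 : ℝ) 1) (hl : ∀ i, 0 < l i) {a b : P}
    (hd : spendingDerivCLM G v l d = Pi.single b 1 - Pi.single a 1)
    (ha : 0 < gainDeriv v l d a) (hb : 0 < gainDeriv v l d b) :
    ∃ B' : P → ℝ, IsContestInstance G v B' ∧
      ∃ τ : ℝ, 0 < τ ∧ IsMutuallyBeneficial c v B' a b τ := by
  -- Isolated players spend nothing; giving them the budget `m i` keeps all budgets positive and
  -- makes `F` locally invertible.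
  set F : (P → ℝ) → P → ℝ := fun m i => spending v m i + isolated G i * m i with hF
  have hinj := hv.injective_spendingDerivCLM hl
  set f' : (P → ℝ) ≃L[ℝ] (P → ℝ) :=
    (LinearEquiv.ofInjectiveEndo (spendingDerivCLM G v l).toLinearMap
      hinj).toContinuousLinearEquiv with hf'
  have hf'_apply : ∀ e, f' e = spendingDerivCLM G v l e := fun e => rfl
  have hstrict : HasStrictFDerivAt F (f' : (P → ℝ) →L[ℝ] (P → ℝ)) l :=
    (hasStrictFDerivAt_spending G v hl).congr_fderiv (by ext1 e; exact (hf'_apply e).symm)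
  set u : P → ℝ := Pi.single b 1 - Pi.single a 1 with hu
  -- The multipliers that realize the budgets after a transfer of `τ`.
  set γ : ℝ → P → ℝ := fun τ => hstrict.localInverse F f' l (F l + τ • u) with hγdef
  have hline : HasDerivAt (fun τ : ℝ => F l + τ • u) u 0 := by
    simpa using ((hasDerivAt_id (0 : ℝ)).smul_const u).const_add (F l)
  have hγ0 : γ 0 = l := by
    simp only [hγdef, zero_smul, add_zero]
    exact hstrict.localInverse_apply_image
  have hγ : HasDerivAt γ d 0 := by
    have h := hstrict.to_localInverse.hasFDerivAt
    rw [show F l = F l + (0 : ℝ) • u by simp] at h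
    have h2 := HasFDerivAt.comp_hasDerivAt (0 : ℝ) h hline
    have h3 : (f'.symm : (P → ℝ) →L[ℝ] (P → ℝ)) u = d := by
      rw [← hd, ← hf'_apply]; exact f'.symm_apply_apply d
    rw [h3] at h2
    exact h2
  have hcont : Tendsto γ (𝓝 0) (𝓝 l) := by simpa [hγ0] using hγ.continuousAt.tendsto
  have hpos : ∀ᶠ τ in 𝓝[>] (0 : ℝ), ∀ i, 0 < γ τ i := by
    refine nhdsWithin_le_nhds (eventually_all.2 fun i => ?_)
    exact ((continuous_apply i).continuousAt.tendsto.comp hcont).eventually_const_lt (hl i)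
  have hright : ∀ᶠ τ in 𝓝[>] (0 : ℝ), F (γ τ) = F l + τ • u := by
    refine nhdsWithin_le_nhds ?_
    have : Tendsto (fun τ : ℝ => F l + τ • u) (𝓝 0) (𝓝 (F l)) := by
      simpa using hline.continuousAt.tendsto
    exact this.eventually hstrict.eventually_right_inverse
  have hgain : ∀ i, 0 < gainDeriv v l d i →
      ∀ᶠ τ in 𝓝[>] (0 : ℝ), gain v l i < gain v (γ τ) i := fun i hi => by
    have h := (hasDerivAt_gain v (by rwa [hγ0]) hγ i).eventually_lt_of_pos (by rwa [hγ0])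
    rwa [hγ0] at h
  have hinst : ∀ m : P → ℝ, (∀ i, 0 < m i) → IsContestInstance G v (F m) := fun m hm =>
    ⟨hv.symm, hv.pos_of_adj, hv.zero_of_not_adj, hv.spending_add_isolated_pos hm⟩
  have hbudget : ∀ (m : P → ℝ) (i j : P), G.Adj i j → F m i = spending v m i :=
    fun m i j hij => by simp only [hF, isolated_of_adj hij, zero_mul, add_zero]
  have hsmall : ∀ᶠ τ in 𝓝[>] (0 : ℝ), τ < F l a :=
    nhdsWithin_le_nhds (eventually_lt_nhds ((hinst l hl).budget_pos a))
  obtain ⟨τ, h1, h2, h3, h4, h5, h6⟩ := (hpos.and (hright.and ((hgain a ha).and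
    ((hgain b hb).and (hsmall.and self_mem_nhdsWithin))))).exists
  have htransfer : transferBudget (F l) a b τ = F (γ τ) := by
    rw [h2, transferBudget]
  refine ⟨F l, hinst l hl, τ, h6, ⟨le_of_lt h6, h5,
    ⟨_, (hinst l hl).isNashEquilibrium_effort hl (hbudget l)⟩, ?_, ?_⟩⟩
  · rw [htransfer]
    exact ⟨_, (hinst _ h1).isNashEquilibrium_effort h1 (hbudget _)⟩
  · intro x x' hx hx'
    rw [htransfer] at hx'
    rw [(hinst l hl).eq_effort hc hl (hbudget l) hx, (hinst _ h1).eq_effort hc h1 (hbudget _) hx',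
      hv.payoff_effort hl, hv.payoff_effort hl, hv.payoff_effort h1, hv.payoff_effort h1]
    exact ⟨h3, h4⟩

end Derivatives

/-! ### Extending values from a subgraph to all edges. -/

section Perturbation

variable {P : Type*} [Fintype P] {G : SimpleGraph P} {w : P → P → ℝ} {l d : P → ℝ}

/-- The unit item values on the edges of `G`. -/
noncomputable def unitValues {P : Type*} (G : SimpleGraph P) (i j : P) : ℝ :=
  open scoped Classical in if G.Adj i j then 1 else 0

theorem unitValues_symm {P : Type*} (G : SimpleGraph P) (i j : P) :
    unitValues G i j = unitValues G j i := by
  unfold unitValues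
  by_cases h : G.Adj i j
  · rw [if_pos h, if_pos h.symm]
  · rw [if_neg h, if_neg fun h' => h h'.symm]

open scoped Classical in
/-- The limiting budget constraints of the values `w + ε • unitValues G` as `ε → 0`, where the
constraints of the players who contest no item of `w` are rescaled by `ε⁻¹`. -/
noncomputable def limitCLM (G : SimpleGraph P) (w : P → P → ℝ) (l : P → ℝ) :
    (P → ℝ) →L[ℝ] (P → ℝ) :=
  ContinuousLinearMap.pi fun i => (ContinuousLinearMap.proj i).comp
    (if ∃ j, w i j ≠ 0 then spendingDerivCLM G w l else spendingDerivCLM G (unitValues G) l)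

open scoped Classical in
/-- The first order term in `ε` of the rescaled budget constraints. -/
noncomputable def correctionCLM (G : SimpleGraph P) (w : P → P → ℝ) (l : P → ℝ) :
    (P → ℝ) →L[ℝ] (P → ℝ) :=
  ContinuousLinearMap.pi fun i => (ContinuousLinearMap.proj i).comp
    (if ∃ j, w i j ≠ 0 then spendingDerivCLM G (unitValues G) l else 0)

/-- The budget `1` is a placeholder; the actual budgets are read off from the multipliers later. -/
theorem isContestInstance_add_smul_unitValues (hsymm : ∀ i j, w i j = w j i)
    (hnn : ∀ i j, 0 ≤ w i j) (hadj : ∀ i j, w i j ≠ 0 → G.Adj i j) {ε : ℝ} (hε : 0 < ε) :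
    IsContestInstance G (w + ε • unitValues G) 1 where
  symm i j := by simp only [Pi.add_apply, Pi.smul_apply, hsymm i j,
    unitValues_symm G i j]
  pos_of_adj i j hij := by
    have := hnn i j
    simp only [Pi.add_apply, Pi.smul_apply, unitValues, if_pos hij, smul_eq_mul]
    linarith
  zero_of_not_adj i j hij := by
    have : w i j = 0 := by_contra fun h => hij (hadj i j h)
    simp [unitValues, if_neg hij, this]
  budget_pos i := one_pos

theorem spendingDeriv_eq_zero_of_forall {i : P} (h : ∀ j, w i j = 0) : spendingDeriv w l d i = 0 :=
  Finset.sum_eq_zero fun j _ => by rw [h j, zero_mul]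

theorem limitCLM_apply_of_ne (hadj : ∀ i j, w i j ≠ 0 → G.Adj i j) {i j : P} (hij : w i j ≠ 0) :
    limitCLM G w l d i = spendingDeriv w l d i := by
  simp [limitCLM, if_pos (⟨j, hij⟩ : ∃ j, w i j ≠ 0), spendingDerivCLM_apply,
    isolated_of_adj (hadj i j hij)]

theorem limitCLM_apply_of_forall {i : P} (h : ∀ j, w i j = 0) :
    limitCLM G w l d i = spendingDerivCLM G (unitValues G) l d i := by
  simp [limitCLM, h]

theorem correctionCLM_apply_of_ne (hadj : ∀ i j, w i j ≠ 0 → G.Adj i j) {i j : P}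
    (hij : w i j ≠ 0) : correctionCLM G w l d i = spendingDeriv (unitValues G) l d i := by
  simp [correctionCLM, if_pos (⟨j, hij⟩ : ∃ j, w i j ≠ 0), spendingDerivCLM_apply,
    isolated_of_adj (hadj i j hij)]

theorem correctionCLM_apply_of_forall {i : P} (h : ∀ j, w i j = 0) :
    correctionCLM G w l d i = 0 := by
  simp [correctionCLM, h]

/-- The rows of players with an item of `w` involve only such players, so this block is negative
definite by itself. -/
theorem eq_zero_of_limitCLM_eq_zero (hsymm : ∀ i j, w i j = w j i) (hnn : ∀ i j, 0 ≤ w i j)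
    (hadj : ∀ i j, w i j ≠ 0 → G.Adj i j) (hl : ∀ i, 0 < l i)
    (h : ∀ i j, w i j ≠ 0 → limitCLM G w l d i = 0) {i j : P} (hij : w i j ≠ 0) : d i = 0 := by
  refine eq_zero_of_mul_spendingDeriv_eq_zero hsymm hnn hl (fun k => ?_) hij
  by_cases hk : ∃ j, w k j ≠ 0
  · obtain ⟨j, hj⟩ := hk
    rw [← limitCLM_apply_of_ne hadj hj, h k j hj, mul_zero]
  · push Not at hk
    rw [spendingDeriv_eq_zero_of_forall hk, mul_zero]

/-- The operator is block triangular. Once the entries on the support of `w` vanish, the remaining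
rows form a principal block for the unit values, again definite apart from isolated vertices. -/
theorem injective_limitCLM (hsymm : ∀ i j, w i j = w j i) (hnn : ∀ i j, 0 ≤ w i j)
    (hadj : ∀ i j, w i j ≠ 0 → G.Adj i j) (hl : ∀ i, 0 < l i) :
    Function.Injective (limitCLM G w l) := by
  rw [injective_iff_map_eq_zero]
  intro d hd
  have hinst : IsContestInstance G (unitValues G) 1 := by
    have := isContestInstance_add_smul_unitValues (G := G) (w := 0) (fun _ _ => rfl)
      (fun _ _ => le_rfl) (fun _ _ h => absurd rfl h) one_pos
    rwa [one_smul, zero_add] at this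
  have hzero : ∀ i j, w i j ≠ 0 → d i = 0 := fun i j hij =>
    eq_zero_of_limitCLM_eq_zero hsymm hnn hadj hl (fun k _ _ => congrFun hd k) hij
  have hnn' : ∀ i j, 0 ≤ unitValues G i j := fun i j => by
    unfold unitValues; split_ifs <;> norm_num
  have hrow : ∀ i, d i ≠ 0 → spendingDerivCLM G (unitValues G) l d i = 0 := fun i hi => by
    rw [← limitCLM_apply_of_forall (w := w) (fun j => by_contra fun h => hi (hzero i j h)), hd]
    rfl
  funext i
  by_contra hi
  have hri := hrow i hi
  rw [spendingDerivCLM_apply] at hri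
  by_cases hij : ∃ j, G.Adj i j
  · obtain ⟨j, hj⟩ := hij
    refine hi (eq_zero_of_mul_spendingDeriv_eq_zero hinst.symm hnn' hl (fun k => ?_)
      (hinst.pos_of_adj i j hj).ne')
    by_cases hk : d k = 0
    · rw [hk, zero_mul]
    · have hrk := hrow k hk
      rw [spendingDerivCLM_apply] at hrk
      by_cases hkj : ∃ j, G.Adj k j
      · obtain ⟨j, hj⟩ := hkj
        rw [isolated_of_adj hj, zero_mul, add_zero] at hrk
        rw [hrk, mul_zero]
      · rw [spendingDeriv_eq_zero_of_forall fun j =>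
          hinst.zero_of_not_adj k j (not_exists.1 hkj j), mul_zero]
  · rw [isolated_of_forall (not_exists.1 hij), spendingDeriv_eq_zero_of_forall fun j =>
      hinst.zero_of_not_adj i j (not_exists.1 hij j), zero_add, one_mul] at hri
    exact hi hri

open scoped Classical in
open Filter Topology in
/-- Values `w` on some of the edges of `G`, with a direction of multipliers that shifts budget from
`a` to `b` and increases the equilibrium payoffs of both, can be perturbed to values that are
positive on all edges of `G`. -/
theorem exists_isContestInstance_of_subgraph (hsymm : ∀ i j, w i j = w j i)
    (hnn : ∀ i j, 0 ≤ w i j) (hadj : ∀ i j, w i j ≠ 0 → G.Adj i j) (hl : ∀ i, 0 < l i) {a b : P}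
    {κ : ℝ} (hκ : 0 < κ) (ha : ∃ j, w a j ≠ 0) (hb : ∃ j, w b j ≠ 0)
    (hd : ∀ i, spendingDeriv w l d i =
      (Pi.single b κ : P → ℝ) i - (Pi.single a κ : P → ℝ) i)
    (hga : 0 < gainDeriv w l d a) (hgb : 0 < gainDeriv w l d b) :
    ∃ (v : P → P → ℝ) (e : P → ℝ), IsContestInstance G v 1 ∧
      spendingDerivCLM G v l e = Pi.single b 1 - Pi.single a 1 ∧
      0 < gainDeriv v l e a ∧ 0 < gainDeriv v l e b := by
  set u : P → ℝ := Pi.single b 1 - Pi.single a 1 with hu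
  set L := limitCLM G w l
  set M := correctionCLM G w l
  have hunit : IsUnit L := by
    have hinj := injective_limitCLM hsymm hnn hadj hl
    rw [ContinuousLinearMap.isUnit_iff_bijective]
    exact ⟨hinj, (LinearMap.injective_iff_surjective (f := L.toLinearMap)).1 hinj⟩
  have hlim : Tendsto (fun ε : ℝ => L + ε • M) (𝓝 0) (𝓝 L) := by
    have : Continuous fun ε : ℝ => L + ε • M := by fun_prop
    simpa using this.tendsto 0
  set e : ℝ → P → ℝ := fun ε => Ring.inverse (L + ε • M) u with he
  set e₀ : P → ℝ := Ring.inverse L u with he₀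
  have hLe₀ : L e₀ = u := by
    rw [he₀, ← mul_apply_eq_comp, Ring.mul_inverse_cancel L hunit]; rfl
  have hlime : Tendsto e (𝓝 0) (𝓝 e₀) := by
    obtain ⟨U, hU⟩ := hunit
    have h := NormedRing.inverse_continuousAt U
    rw [hU] at h
    have h2 := (h.tendsto.comp hlim)
    exact ((ContinuousLinearMap.apply ℝ (P → ℝ) u).continuous.tendsto _).comp h2
  have hsol : ∀ᶠ ε in 𝓝 (0 : ℝ), (L + ε • M) (e ε) = u := by
    have : ∀ᶠ x in 𝓝 L, IsUnit x := Units.isOpen.mem_nhds hunit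
    filter_upwards [hlim.eventually this] with ε hε
    rw [he, ← mul_apply_eq_comp, Ring.mul_inverse_cancel _ hε]; rfl
  -- On the support of `w` the limit system has a unique solution, so `e₀` is there the given
  -- direction normalized to a unit shift.
  have hagree : ∀ i j, w i j ≠ 0 → e₀ i = κ⁻¹ * d i := fun i j hij => by
    have : (e₀ + (-κ⁻¹) • d) i = 0 := by
      refine eq_zero_of_limitCLM_eq_zero hsymm hnn hadj hl (fun k m hkm => ?_) hij
      rw [limitCLM_apply_of_ne hadj hkm, spendingDeriv_add, spendingDeriv_smul, hd,
        ← limitCLM_apply_of_ne hadj hkm, show limitCLM G w l e₀ = u from hLe₀, hu]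
      simp only [Pi.sub_apply, Pi.single_apply]
      split_ifs <;> field_simp <;> ring
    simp only [Pi.add_apply, Pi.smul_apply, smul_eq_mul] at this
    linarith
  have hgain : ∀ i, 0 < gainDeriv w l d i →
      ∀ᶠ ε in 𝓝 (0 : ℝ), 0 < gainDeriv (w + ε • unitValues G) l (e ε) i := fun i hi => by
    have hval : gainDeriv w l e₀ i = κ⁻¹ * gainDeriv w l d i := by
      simp only [gainDeriv, Finset.mul_sum]
      refine Finset.sum_congr rfl fun j _ => ?_
      by_cases hij : w i j = 0
      · rw [hij]; ring
      · rw [hagree i j hij, hagree j i (by rwa [hsymm j i])]; ring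
    have hlimg : Tendsto (fun ε => gainDeriv (w + ε • unitValues G) l (e ε) i) (𝓝 0)
        (𝓝 (gainDeriv w l e₀ i)) := by
      refine tendsto_finsetSum _ fun j _ => ?_
      have hej : ∀ j, Tendsto (fun ε => e ε j) (𝓝 0) (𝓝 (e₀ j)) := tendsto_pi_nhds.1 hlime
      refine Tendsto.mul ?_ ((((hej j).const_mul _).sub ((hej i).const_mul _)).div_const _)
      have : Continuous fun ε : ℝ => (w + ε • unitValues G) i j := by
        simp only [Pi.add_apply, Pi.smul_apply, smul_eq_mul]; fun_prop
      simpa using this.tendsto 0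
    refine hlimg.eventually_const_lt ?_
    rw [hval]
    positivity
  have hev := (hsol.and ((hgain a hga).and (hgain b hgb))).filter_mono
    (nhdsWithin_le_nhds (s := Set.Ioi (0 : ℝ)))
  obtain ⟨ε, ⟨h1, h2, h3⟩, hε⟩ := (hev.and self_mem_nhdsWithin).exists
  refine ⟨_, e ε, isContestInstance_add_smul_unitValues hsymm hnn hadj hε, ?_, h2, h3⟩
  funext i
  have hi := congrFun h1 i
  simp only [add_apply, smul_apply, Pi.add_apply, Pi.smul_apply, smul_eq_mul] at hi
  rw [spendingDerivCLM_apply, spendingDeriv_add_smul]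
  by_cases hw : ∃ j, w i j ≠ 0
  · obtain ⟨j, hj⟩ := hw
    rw [limitCLM_apply_of_ne hadj hj, correctionCLM_apply_of_ne hadj hj] at hi
    rw [isolated_of_adj (hadj i j hj), zero_mul, add_zero, hi]
  -- Rescaling this row by `ε⁻¹` was harmless: its right-hand side is zero because `a` and `b` both
  -- contest items of `w`.
  · have hui : u i = 0 := by
      have hia : i ≠ a := fun h => hw (h ▸ ha)
      have hib : i ≠ b := fun h => hw (h ▸ hb)
      simp [hu, hia, hib]
    push Not at hw
    rw [limitCLM_apply_of_forall hw, correctionCLM_apply_of_forall hw, mul_zero, add_zero, hui,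
      spendingDerivCLM_apply] at hi
    rw [spendingDeriv_eq_zero_of_forall hw, zero_add, hui]
    by_cases hij : ∃ j, G.Adj i j
    · obtain ⟨j, hj⟩ := hij
      rw [isolated_of_adj hj, zero_mul, add_zero] at hi ⊢
      rw [hi, mul_zero]
    · rw [spendingDeriv_eq_zero_of_forall fun j => if_neg (not_exists.1 hij j), zero_add] at hi
      rw [spendingDeriv_eq_zero_of_forall fun j => if_neg (not_exists.1 hij j), hi, mul_zero,
        zero_add]

end Perturbation

/-! ### Explicit directions along a chain. -/

/-- The sequence `f` shifted by one, with first term `x`. -/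
def prepend (x : ℝ) (f : ℕ → ℝ) : ℕ → ℝ
  | 0 => x
  | i + 1 => f i

theorem prepend_succ (x : ℝ) (f : ℕ → ℝ) (i : ℕ) : prepend x f (i + 1) = f i := rfl

theorem prepend_pos {x : ℝ} {f : ℕ → ℝ} (hx : 0 < x) (hf : ∀ i, 0 < f i) :
    ∀ i, 0 < prepend x f i
  | 0 => hx
  | i + 1 => hf i

theorem effortDeriv_prepend (x y : ℝ) (l d : ℕ → ℝ) (i j : ℕ) :
    effortDeriv (prepend x l) (prepend y d) (i + 1) (j + 1) = effortDeriv l d i j := rfl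

theorem effortDeriv_half_four (l d : ℕ → ℝ) (hl : ∀ i, 0 < l i) (i j : ℕ) :
    effortDeriv (fun i => l i / 2) (fun i => 4 * d i) i j = 16 * effortDeriv l d i j := by
  have h : l i + l j ≠ 0 := (add_pos (hl i) (hl j)).ne'
  have h' : l i / 2 + l j / 2 ≠ 0 := by rw [← add_div]; exact div_ne_zero h two_ne_zero
  simp only [effortDeriv]
  rw [show l i / 2 + l j / 2 = (l i + l j) / 2 by ring]
  field_simp
  ring

/-- A chain of multipliers along which an increase of the spending of the last player by an
arbitrarily small amount is met by an increase of the spending of the first player by one, at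
unchanged spendings of the players in between. -/
theorem exists_chain (n : ℕ) : ∀ η : ℝ, 0 < η → ∃ l d w : ℕ → ℝ, (∀ i, 0 < l i) ∧ (∀ i, 0 < w i) ∧
    l 0 = 1 ∧ d 0 = 1 ∧ w 0 * effortDeriv l d 0 1 = 1 ∧
    (∀ i < n, w i * effortDeriv l d (i + 1) i + w (i + 1) * effortDeriv l d (i + 1) (i + 2) = 0) ∧
    0 < w n * effortDeriv l d (n + 1) n ∧ w n * effortDeriv l d (n + 1) n < η ∧
    0 < l (n + 1) * d n - l n * d (n + 1) := by
  induction n with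
  | zero =>
    intro η hη
    -- With multipliers `1, μ` and directions `1, -μ`, the ratio of the last to the first spending
    -- change is `(3 * μ - 1) / (μ * (μ - 3))`, which is less than `3 / (μ - 3) = η`.
    set μ : ℝ := 3 + 3 / η with hμ
    have h3 : 0 < 3 / η := by positivity
    have hμ3 : 0 < μ - 3 := by linarith
    have hμ0 : 0 < μ := by linarith
    have hfirst : ((1 - μ) * -μ - 2 * μ * 1) / (1 + μ) ^ 3 = μ * (μ - 3) / (1 + μ) ^ 3 := by ring
    have hlast : (1 + μ) ^ 3 / (μ * (μ - 3)) * (((μ - 1) * 1 - 2 * 1 * -μ) / (μ + 1) ^ 3) =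
        (3 * μ - 1) / (μ * (μ - 3)) := by
      rw [add_comm μ 1]
      field_simp
      ring
    refine ⟨prepend 1 fun _ => μ, prepend 1 fun _ => -μ,
      fun _ => (1 + μ) ^ 3 / (μ * (μ - 3)), prepend_pos one_pos fun _ => hμ0,
      fun _ => by positivity, rfl, rfl, ?_, by simp, ?_, ?_, ?_⟩
    · simp only [effortDeriv, prepend, hfirst]
      field_simp
    · simp only [effortDeriv, prepend, hlast]
      have : 0 < 3 * μ - 1 := by linarith
      positivity
    · simp only [effortDeriv, prepend, hlast]
      rw [div_lt_iff₀ (by positivity)]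
      have : η * (μ - 3) = 3 := by rw [hμ]; field_simp; ring
      have : η * (μ * (μ - 3)) = 3 * μ := by linear_combination μ * this
      linarith
    · simp only [prepend]
      linarith
  | succ n ih =>
    intro η hη
    -- Prepending a player amplifies the last spending change by `17 / 2`; this is why the induction
    -- needs arbitrarily small `η`.
    obtain ⟨l, d, w, hl, hw, hl0, hd0, hfirst, hmid, hpos, hlt, hend⟩ :=
      ih (η / (17 / 2)) (by positivity)
    have hD := effortDeriv_half_four l d hl
    -- The first two players now have multipliers `1, 1/2` and directions `1, 4`. The weight `27 /
    -- 8` normalizes the first change to one and changes the second player's effort there by `-17 /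
    -- 2`; the old chain, scaled by `17 / 32 * 16 = 17 / 2`, compensates.
    refine ⟨prepend 1 fun i => l i / 2, prepend 1 fun i => 4 * d i,
      prepend (27 / 8) fun i => 17 / 32 * w i, prepend_pos one_pos fun i => half_pos (hl i),
      prepend_pos (by norm_num) fun i => mul_pos (by norm_num) (hw i), rfl, rfl, ?_, ?_, ?_, ?_, ?_⟩
    · simp only [effortDeriv, prepend, hl0, hd0]
      norm_num
    · intro i hi
      rcases i with - | i
      · have h1 : effortDeriv (prepend 1 fun i => l i / 2) (prepend 1 fun i => 4 * d i) 1 0 =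
            -(68 / 27) := by
          simp only [effortDeriv, prepend, hl0, hd0]
          norm_num
        rw [zero_add, zero_add, h1, effortDeriv_prepend, hD]
        simp only [prepend]
        linear_combination 17 / 2 * hfirst
      · rw [effortDeriv_prepend, effortDeriv_prepend, hD, hD]
        simp only [prepend_succ]
        linear_combination 17 / 2 * hmid i (by lia)
    · rw [effortDeriv_prepend, hD, prepend_succ]
      linarith
    · rw [effortDeriv_prepend, hD, prepend_succ]
      rw [lt_div_iff₀ (by norm_num)] at hlt
      linarith
    · simp only [prepend_succ]
      linarith

/-- A direction of multipliers along a path of length `n + 2` that shifts the budget `κ` from the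
first to the last player and increases the payoffs of both. -/
theorem exists_beneficial_chain (n : ℕ) : ∃ (l d w : ℕ → ℝ) (κ : ℝ), (∀ i, 0 < l i) ∧
    (∀ i, 0 < w i) ∧ 0 < κ ∧ w 0 * effortDeriv l d 0 1 = -κ ∧
    (∀ i < n + 1,
      w i * effortDeriv l d (i + 1) i + w (i + 1) * effortDeriv l d (i + 1) (i + 2) = 0) ∧
    w (n + 1) * effortDeriv l d (n + 2) (n + 1) = κ ∧
    0 < l 0 * d 1 - l 1 * d 0 ∧ 0 < l (n + 2) * d (n + 1) - l (n + 1) * d (n + 2) := by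
  obtain ⟨l, d, w, hl, hw, hl0, hd0, hfirst, hmid, hpos, hlt, hend⟩ := exists_chain n 1 one_pos
  set r := w n * effortDeriv l d (n + 1) n with hr
  -- On the new first item both multipliers are `1`. The first player's effort falls by `2 * r` and
  -- the rival's by `2`, and `r < 1` makes the first player gain.
  refine ⟨prepend 1 l, prepend r d, prepend 8 fun i => 2 * w i, 2 * r, prepend_pos one_pos hl,
    prepend_pos (by norm_num) fun i => mul_pos two_pos (hw i), by positivity, ?_, ?_, ?_, ?_, ?_⟩
  · simp only [effortDeriv, prepend, hl0, hd0]
    ring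
  · intro i hi
    rcases i with - | i
    · have h1 : effortDeriv (prepend 1 l) (prepend r d) 1 0 = -(1 / 4) := by
        simp only [effortDeriv, prepend, hl0, hd0]
        norm_num
      rw [zero_add, zero_add, h1, effortDeriv_prepend]
      simp only [prepend]
      linear_combination 2 * hfirst
    · rw [effortDeriv_prepend, effortDeriv_prepend]
      simp only [prepend_succ]
      linear_combination 2 * hmid i (by lia)
  · rw [effortDeriv_prepend, prepend_succ, hr]
    ring
  · simp only [prepend, hl0, hd0]
    linarith
  · simpa only [prepend_succ] using hend

/-! ### Placing the chain on a path of the graph. -/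

section Path

variable {P : Type*}

open scoped Classical in
/-- The item values `w i` on the edges `p i, p (i + 1)`, `i < m`, of a path. -/
noncomputable def pathValues (p : ℕ → P) (w : ℕ → ℝ) (m : ℕ) (x y : P) : ℝ :=
  ∑ i ∈ Finset.range m, w i * ((if x = p i ∧ y = p (i + 1) then 1 else 0) +
    if x = p (i + 1) ∧ y = p i then 1 else 0)

open scoped Classical in
theorem pathValues_symm (p : ℕ → P) (w : ℕ → ℝ) (m : ℕ) (x y : P) :
    pathValues p w m x y = pathValues p w m y x := by
  refine Finset.sum_congr rfl fun i _ => ?_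
  rw [add_comm]
  congr 2 <;> exact if_congr and_comm rfl rfl

theorem pathValues_nonneg (p : ℕ → P) {w : ℕ → ℝ} (hw : ∀ i, 0 < w i) (m : ℕ) (x y : P) :
    0 ≤ pathValues p w m x y :=
  Finset.sum_nonneg fun i _ => mul_nonneg (hw i).le
    (add_nonneg (by split_ifs <;> norm_num) (by split_ifs <;> norm_num))

theorem exists_of_pathValues_ne_zero {p : ℕ → P} {w : ℕ → ℝ} {m : ℕ} {x y : P}
    (h : pathValues p w m x y ≠ 0) :
    ∃ i < m, (x = p i ∧ y = p (i + 1)) ∨ (x = p (i + 1) ∧ y = p i) := by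
  obtain ⟨i, hi, hne⟩ := Finset.exists_ne_zero_of_sum_ne_zero h
  refine ⟨i, Finset.mem_range.1 hi, ?_⟩
  by_contra hcon
  rw [not_or] at hcon
  rw [if_neg hcon.1, if_neg hcon.2] at hne
  simp at hne

theorem pathValues_pos {p : ℕ → P} {w : ℕ → ℝ} (hw : ∀ i, 0 < w i) {m i : ℕ} (hi : i < m) :
    0 < pathValues p w m (p i) (p (i + 1)) := by
  refine Finset.sum_pos' (fun j _ => mul_nonneg (hw j).le
    (add_nonneg (by split_ifs <;> norm_num) (by split_ifs <;> norm_num)))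
    ⟨i, Finset.mem_range.2 hi, mul_pos (hw i) ?_⟩
  rw [if_pos ⟨rfl, rfl⟩]
  split_ifs <;> norm_num

open scoped Classical in
theorem sum_pathValues_mul [Fintype P] (p : ℕ → P) (w : ℕ → ℝ) (m : ℕ) (x : P) (h : P → P → ℝ) :
    ∑ y, pathValues p w m x y * h x y =
      ∑ i ∈ Finset.range m, ((if x = p i then w i * h (p i) (p (i + 1)) else 0) +
        if x = p (i + 1) then w i * h (p (i + 1)) (p i) else 0) := by
  simp only [pathValues, Finset.sum_mul]
  rw [Finset.sum_comm]
  refine Finset.sum_congr rfl fun i _ => ?_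
  simp only [mul_add, add_mul, Finset.sum_add_distrib]
  congr 1
  · by_cases hx : x = p i
    · simp [hx]
    · simp [hx]
  · by_cases hx : x = p (i + 1)
    · simp [hx]
    · simp [hx]

open scoped Classical in
/-- Along a path, a direction of multipliers exists that shifts budget from the first to the last
player and increases the payoffs of both. -/
theorem exists_pathValues [Fintype P] {p : ℕ → P} {n : ℕ} (hp : Set.InjOn p {i | i ≤ n + 2}) :
    ∃ (w : ℕ → ℝ) (l d : P → ℝ) (κ : ℝ), (∀ i, 0 < w i) ∧ (∀ x, 0 < l x) ∧ 0 < κ ∧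
      (∀ x, spendingDeriv (pathValues p w (n + 2)) l d x =
        (Pi.single (p (n + 2)) κ : P → ℝ) x - (Pi.single (p 0) κ : P → ℝ) x) ∧
      0 < gainDeriv (pathValues p w (n + 2)) l d (p 0) ∧
      0 < gainDeriv (pathValues p w (n + 2)) l d (p (n + 2)) := by
  obtain ⟨l, d, w, κ, hl, hw, hκ, hfirst, hmid, hlast, hga, hgb⟩ := exists_beneficial_chain n
  -- Off the path `q` takes junk values, which is harmless: `l` is positive everywhere and
  -- `pathValues` vanishes there.
  set q : P → ℕ := Function.invFunOn p {i | i ≤ n + 2} with hq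
  have hqp : ∀ i ≤ n + 2, q (p i) = i := fun i hi => hp.leftInvOn_invFunOn hi
  have hinj : ∀ i ≤ n + 2, ∀ j ≤ n + 2, p i = p j → i = j := fun i hi j hj h => hp hi hj h
  refine ⟨w, l ∘ q, d ∘ q, κ, hw, fun x => hl _, hκ, ?_, ?_, ?_⟩
  · intro x
    have hD : ∀ i ≤ n + 2, ∀ j ≤ n + 2,
        effortDeriv (l ∘ q) (d ∘ q) (p i) (p j) = effortDeriv l d i j := fun i hi j hj => by
      simp only [effortDeriv, Function.comp_apply, hqp i hi, hqp j hj]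
    rw [spendingDeriv, sum_pathValues_mul, Finset.sum_add_distrib, Finset.sum_range_succ',
      Finset.sum_range_succ _ (n + 1)]
    rw [zero_add, hD 0 (by lia) 1 (by lia), hD (n + 1 + 1) (by lia) (n + 1) (by lia), hfirst, hlast]
    -- With the two end contributions split off, each interior vertex `p (k + 1)` meets a forward
    -- and a backward edge, whose contributions cancel.
    have hz : ∑ k ∈ Finset.range (n + 1), (if x = p (k + 1) then
          w (k + 1) * effortDeriv (l ∘ q) (d ∘ q) (p (k + 1)) (p (k + 1 + 1)) else 0) +
        ∑ k ∈ Finset.range (n + 1), (if x = p (k + 1) then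
          w k * effortDeriv (l ∘ q) (d ∘ q) (p (k + 1)) (p k) else 0) = 0 := by
      rw [← Finset.sum_add_distrib]
      refine Finset.sum_eq_zero fun k hk => ?_
      rw [Finset.mem_range] at hk
      split_ifs
      · rw [hD (k + 1) (by lia) (k + 1 + 1) (by lia), hD (k + 1) (by lia) k (by lia)]
        linarith [hmid k hk]
      · exact add_zero 0
    simp only [Pi.single_apply]
    have h0 : (if x = p 0 then -κ else 0) = -(if x = p 0 then κ else 0) := by
      split_ifs <;> simp
    rw [h0, show n + 1 + 1 = n + 2 from rfl]
    linarith
  · have hnn : ∀ y, 0 ≤ pathValues p w (n + 2) (p 0) y := pathValues_nonneg p hw _ _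
    rw [gainDeriv]
    refine Finset.sum_pos' (fun y _ => ?_) ⟨p 1, Finset.mem_univ _, ?_⟩
    · by_cases hy : pathValues p w (n + 2) (p 0) y = 0
      · rw [hy, zero_mul]
      · obtain ⟨i, hi, ⟨h1, h2⟩ | ⟨h1, h2⟩⟩ := exists_of_pathValues_ne_zero hy
        · have := hinj 0 (by lia) i (by lia) h1
          subst this
          refine mul_nonneg (hnn y) (div_nonneg ?_ (sq_nonneg _))
          simp only [h2, Function.comp_apply, hqp 0 (by lia), hqp (0 + 1) (by lia)]
          exact hga.le
        · have := hinj 0 (by lia) (i + 1) (by lia) h1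
          lia
    · refine mul_pos (pathValues_pos hw (by lia)) (div_pos ?_ (pow_pos (add_pos (hl _) (hl _)) 2))
      simp only [Function.comp_apply, hqp 0 (by lia), hqp 1 (by lia)]
      exact hga
  · have hnn : ∀ y, 0 ≤ pathValues p w (n + 2) (p (n + 2)) y := pathValues_nonneg p hw _ _
    rw [gainDeriv]
    refine Finset.sum_pos' (fun y _ => ?_) ⟨p (n + 1), Finset.mem_univ _, ?_⟩
    · by_cases hy : pathValues p w (n + 2) (p (n + 2)) y = 0
      · rw [hy, zero_mul]
      · obtain ⟨i, hi, ⟨h1, h2⟩ | ⟨h1, h2⟩⟩ := exists_of_pathValues_ne_zero hy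
        · have := hinj (n + 2) (by lia) i (by lia) h1
          lia
        · have := hinj (n + 2) (by lia) (i + 1) (by lia) h1
          obtain rfl : i = n + 1 := by lia
          refine mul_nonneg (hnn y) (div_nonneg ?_ (sq_nonneg _))
          simp only [h2, Function.comp_apply, hqp (n + 2) (by lia), hqp (n + 1) (by lia)]
          exact hgb.le
    · refine mul_pos ?_ (div_pos ?_ (pow_pos (add_pos (hl _) (hl _)) 2))
      · rw [pathValues_symm]
        exact pathValues_pos hw (by lia)
      · simp only [Function.comp_apply, hqp (n + 2) (by lia), hqp (n + 1) (by lia)]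
        exact hgb

end Path

theorem theorem1 {P : Type*} [Fintype P] (G : SimpleGraph P) (a b : P) (hab : a ≠ b)
    (hpath : (G.deleteEdges {s(a, b)}).Reachable a b)
    (c : ℝ) (hc : c ∈ Set.Ioo (0 : ℝ) 1) :
    ∃ (v : P → P → ℝ) (B : P → ℝ), IsContestInstance G v B ∧
      ∃ τ : ℝ, 0 < τ ∧ IsMutuallyBeneficial c v B a b τ := by
  classical
  obtain ⟨r, hr⟩ := hpath.exists_isPath
  have hadj : ∀ i < r.length, G.Adj (r.getVert i) (r.getVert (i + 1)) := fun i hi =>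
    SimpleGraph.deleteEdges_le _ (r.adj_getVert_succ hi)
  have hinj := hr.getVert_injOn
  have hend := r.getVert_length
  -- A path of length one would be the deleted edge; the chain needs at least one intermediate
  -- player.
  have hlen : 2 ≤ r.length := by
    by_contra! hlt
    have h0 : r.length ≠ 0 := fun h => hab (SimpleGraph.Walk.eq_of_length_eq_zero h)
    have h1 : r.length = 1 := by lia
    have := SimpleGraph.Walk.adj_of_length_eq_one h1
    simp [SimpleGraph.deleteEdges_adj] at this
  obtain ⟨n, hn⟩ : ∃ n, r.length = n + 2 := ⟨r.length - 2, by lia⟩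
  have hstart := r.getVert_zero
  rw [hn] at hadj hinj hend
  generalize r.getVert = p at hadj hinj hend hstart
  obtain ⟨w, l, d, κ, hw, hl, hκ, hd, hga, hgb⟩ := exists_pathValues hinj
  subst hstart hend
  have hb : pathValues p w (n + 2) (p (n + 2)) (p (n + 1)) ≠ 0 := by
    rw [pathValues_symm]
    exact (pathValues_pos hw (by lia)).ne'
  have ha : pathValues p w (n + 2) (p 0) (p 1) ≠ 0 := (pathValues_pos hw (by lia)).ne'
  obtain ⟨v, e, hv, he, hea, heb⟩ := exists_isContestInstance_of_subgraph
    (pathValues_symm p w _) (pathValues_nonneg p hw _) (fun x y hxy => by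
      obtain ⟨i, hi, ⟨rfl, rfl⟩ | ⟨rfl, rfl⟩⟩ := exists_of_pathValues_ne_zero hxy
      · exact hadj i hi
      · exact (hadj i hi).symm) hl hκ ⟨_, ha⟩ ⟨_, hb⟩ hd hga hgb
  obtain ⟨B, hB⟩ := hv.exists_isMutuallyBeneficial hc hl he hea heb
  exact ⟨v, B, hB⟩
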